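/- Let $n\ge 2$, let $\Omega\subset B_R\subset\mathbb{R}^n$ be open and convex, where $B_R$ is the Euclidean ball of radius $R$ around the origin, let $f\in L^1(\Omega)$ with $0\le f\le\Lambda<\infty$, let $\alpha\in(0,1]$, and let $g\in C^{\alpha}(\overline\Omega)$ (that is, $g$ is $\alpha$-Hölder continuous on $\overline\Omega$) be convex. Let $u\in C(\overline\Omega)$ be a convex Alexandrov solution of $\det D^2u=f$ in $\Omega$, $u=g$ on $\partial\Omega$; that is, $u=g$ on $\partial\Omega$ and, for every Borel set $A\subset\Omega$, $$\Big|\bigcup_{x\in A}\partial u(x)\Big|=\int_A f\,dx,\qquad \partial u(x):=\{\xi\in\mathbb{R}^n : u(y)\ge u(x)+\langle\xi,y-x\rangle\ \text{for all } y\in\Omega\},$$ where $|\cdot|$ is the Lebesgue measure. Let $\omega_g(\delta):=\sup\{|g(x)-g(y)| : x,y\in\overline\Omega,\ |x-y|\le\delta\}$, $\delta\ge 0$, be the modulus of continuity of $g$. Then $u$ has a weak gradient $\nabla u\in L^1_{\mathrm{loc}}(\Omega)$, and for all $p,\beta\in[0,\infty)$ with $q:=(1-\min\{2/n,\alpha\})p-\beta<1$,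 $$\int_\Omega|\nabla u(x)|^p\operatorname{dist}(x,\partial\Omega)^\beta\,dx\le C<\infty,$$ where the constant $C=C(n,R,\Lambda,p,\beta,\omega_g)$ depends only on $n$, $R$, $\Lambda$, $p$, $\beta$ and the function $\omega_g$. In particular, $u\in W^{1,p}(\Omega)$ for all $1\le p<(1-\min\{2/n,\alpha\})^{-1}$ (where the right-hand side is read as $\infty$ if $n=2$ and $\alpha=1$). -/

import Mathlib

open MeasureTheory Set
open scoped NNReal ENNReal ContDiff

/-- The subdifferential on `Ω` of a function `u` at `x`:
all `ξ` with `u ≥ u x + ⟨ξ, · - x⟩` in `Ω`. -/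
def subdifferential {n : ℕ} (Ω : Set (EuclideanSpace ℝ (Fin n)))
    (u : EuclideanSpace ℝ (Fin n) → ℝ) (x : EuclideanSpace ℝ (Fin n)) :
    Set (EuclideanSpace ℝ (Fin n)) :=
  {ξ | ∀ y ∈ Ω, u x + inner ℝ ξ (y - x) ≤ u y}

/-- The Monge–Ampère measure of `u` on `Ω`, as a set function: the Lebesgue measure of the union
of the subdifferentials of `u` at the points of `A`. It is only evaluated at Borel sets
`A ⊆ Ω`. -/
noncomputable def mongeAmpereMeasure {n : ℕ} (Ω : Set (EuclideanSpace ℝ (Fin n)))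
    (u : EuclideanSpace ℝ (Fin n) → ℝ) (A : Set (EuclideanSpace ℝ (Fin n))) : ℝ≥0∞ :=
  volume (⋃ x ∈ A, subdifferential Ω u x)

/-- `u` is a convex Alexandrov solution, continuous on the closure of `Ω`, of the Dirichlet problem
`det D²u = f` in `Ω`, `u = g` on `∂Ω`. -/
structure IsAlexandrovSolution {n : ℕ} (Ω : Set (EuclideanSpace ℝ (Fin n)))
    (f g u : EuclideanSpace ℝ (Fin n) → ℝ) : Prop where
  convexOn : ConvexOn ℝ (closure Ω) u
  continuousOn : ContinuousOn u (closure Ω)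
  measure_eq : ∀ A : Set (EuclideanSpace ℝ (Fin n)), MeasurableSet A → A ⊆ Ω →
    mongeAmpereMeasure Ω u A = ∫⁻ x in A, ENNReal.ofReal (f x)
  boundary_eq : ∀ x ∈ frontier Ω, u x = g x

/-- The modulus of continuity of `g` on `closure Ω`:
the supremum of `|g x - g y|` over `x, y ∈ closure Ω` with `|x - y| ≤ δ`. -/
noncomputable def modulusOfContinuity {n : ℕ} (Ω : Set (EuclideanSpace ℝ (Fin n)))
    (g : EuclideanSpace ℝ (Fin n) → ℝ) (δ : ℝ) : ℝ≥0∞ :=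
  ⨆ (x ∈ closure Ω) (y ∈ closure Ω) (_ : dist x y ≤ δ), ENNReal.ofReal |g x - g y|

/-- `v` is the weak gradient of `u` in `Ω`: both are locally integrable in `Ω` and
`∫ u ∂ᵢφ = - ∫ vᵢ φ` for all `i` and all smooth `φ` with compact support in `Ω`. -/
structure IsWeakGradient {n : ℕ} (Ω : Set (EuclideanSpace ℝ (Fin n)))
    (u : EuclideanSpace ℝ (Fin n) → ℝ)
    (v : EuclideanSpace ℝ (Fin n) → EuclideanSpace ℝ (Fin n)) : Prop where
  locallyIntegrableOn : LocallyIntegrableOn u Ω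
  locallyIntegrableOn_grad : LocallyIntegrableOn v Ω
  integral_eq : ∀ φ : EuclideanSpace ℝ (Fin n) → ℝ, ContDiff ℝ ∞ φ → HasCompactSupport φ →
    tsupport φ ⊆ Ω → ∀ i : Fin n,
      ∫ x in Ω, u x * fderiv ℝ φ x (EuclideanSpace.single i 1) = - ∫ x in Ω, v x i * φ x

/-- The Sobolev space `W^{1,p}(Ω)`: `u ∈ L^p(Ω)` with a weak gradient in `L^p(Ω)`. -/
def MemW1p {n : ℕ} (Ω : Set (EuclideanSpace ℝ (Fin n))) (p : ℝ≥0∞)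
    (u : EuclideanSpace ℝ (Fin n) → ℝ) : Prop :=
  MemLp u p (volume.restrict Ω) ∧
    ∃ v, IsWeakGradient Ω u v ∧ MemLp v p (volume.restrict Ω)

/-- The assumptions on the data: `Ω` is open and convex and contained in the ball of radius `R`
around the origin, `0 ≤ f ≤ Λ` is an integrable function on `Ω`, `g` is convex and `α`-Hölder
continuous on `closure Ω`, and `u` is the convex Alexandrov solution for the data `f`, `g`. -/
structure IsHolderDirichletData {n : ℕ} (R Λ : ℝ) (α : ℝ≥0)
    (Ω : Set (EuclideanSpace ℝ (Fin n))) (f g u : EuclideanSpace ℝ (Fin n) → ℝ) : Prop where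
  isOpen : IsOpen Ω
  convex : Convex ℝ Ω
  subset_ball : Ω ⊆ Metric.ball 0 R
  integrableOn : IntegrableOn f Ω
  bounds : ∀ᵐ x ∂volume.restrict Ω, 0 ≤ f x ∧ f x ≤ Λ
  convexOn : ConvexOn ℝ (closure Ω) g
  holder : ∃ K : ℝ≥0, HolderOnWith K α g (closure Ω)
  solution : IsAlexandrovSolution Ω f g u

/-! Fix `γ` slightly below `min (2/n) α`; the strict inequality on the exponent leaves room for this
loss, and it ensures `γ < 1`. Everything follows from the pointwise bound `‖∇u(x)‖ ≤ C d(x)^(γ-1)`,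
where `d` is the distance to the boundary.

For this bound, take a boundary point `z`, a supporting half-space `⟨ν, · - z⟩ ≥ 0` at `z`, and the
barrier `t^γ (‖x'‖² - M)` with `t = ⟨ν, x - z⟩` and `x'` the part of `x - z` orthogonal to `ν`. Its
Hessian determinant behaves like `t^(γn-2)`, which stays away from zero on bounded sets exactly when
`γ ≤ 2/n`. A large multiple of it, added to an affine minorant of `g` that almost touches `g` at
`x`, is a subsolution lying below `u` on the boundary. By `comparison_of_subsolution`, `u(x) ≥ g(x)
- C |x - z|^γ` (`exists_boundary_lower_bound`).

If `ξ` is a subgradient at `x`, follow the direction of `ξ` to the boundary. The growth `s ‖ξ‖` over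
the length `s` is at most `g(z) - u(x) ≤ (K + C) s^γ`, and `s ≥ d(x)` (`exists_subgradient_bound`).

It remains to integrate `d^(-q)` with `q < 1`. Boundary layers of a convex set have volume `O(t)`
(`volume_infDist_lt_le`), so the layer cake formula suffices. Convex functions are locally
Lipschitz, so the weak gradient is almost everywhere a subgradient. -/

/-! ### Comparison principle for smooth strict subsolutions. -/

theorem strict_gradient_inequality {E : Type*} [NormedAddCommGroup E] [InnerProductSpace ℝ E]
    {Ω : Set E} (hΩ : IsOpen Ω) (hc : Convex ℝ Ω) {v : E → ℝ} {G : E → E} {H : E → E →L[ℝ] E}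
    (hv : ContinuousOn v (closure Ω)) (hG : ∀ y ∈ Ω, HasFDerivAt v (innerSL ℝ (G y)) y)
    (hH : ∀ y ∈ Ω, HasFDerivAt G (H y) y) (hpos : ∀ y ∈ Ω, ∀ h, h ≠ 0 → 0 < inner ℝ (H y h) h)
    {x y : E} (hx : x ∈ closure Ω) (hy : y ∈ Ω) (hxy : x ≠ y) :
    v y + inner ℝ (G y) (x - y) < v x := by
  set h := x - y with hh
  have h0 : h ≠ 0 := sub_ne_zero.2 hxy
  have hmem : ∀ s ∈ Ico (0 : ℝ) 1, y + s • h ∈ Ω := by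
    intro s hs
    have h1 := hc.combo_interior_closure_mem_interior (x := y) (y := x) (a := 1 - s) (b := s)
      (by rwa [hΩ.interior_eq]) hx (by linarith [hs.2]) hs.1 (by ring)
    rw [hΩ.interior_eq] at h1
    convert h1 using 1
    rw [hh]; module
  have hcl : ∀ s ∈ Icc (0 : ℝ) 1, y + s • h ∈ closure Ω := by
    intro s hs
    rcases eq_or_lt_of_le hs.2 with h1 | h1
    · rw [h1, hh]; simpa using hx
    · exact subset_closure (hmem s ⟨hs.1, h1⟩)
  have hline : ∀ s : ℝ, HasDerivAt (fun s : ℝ => y + s • h) h s := fun s => by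
    simpa using ((hasDerivAt_id s).smul_const h).const_add y
  have hd1 : ∀ s ∈ Ico (0 : ℝ) 1,
      HasDerivAt (fun s : ℝ => v (y + s • h)) (inner ℝ (G (y + s • h)) h) s := fun s hs => by
    have := (hG _ (hmem s hs)).comp_hasDerivAt s (hline s)
    exact this
  have hd2 : ∀ s ∈ Ico (0 : ℝ) 1,
      HasDerivAt (fun s : ℝ => inner ℝ (G (y + s • h)) h)
        (inner ℝ (H (y + s • h) h) h) s := fun s hs => by
    have := ((hH _ (hmem s hs)).comp_hasDerivAt s (hline s)).inner ℝ (hasDerivAt_const s h)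
    simpa using this
  -- The mean value theorem is used twice: `v x - v y` is the directional derivative at some `c`,
  -- and this exceeds the one at `0` because the second derivative is positive in between. Only
  -- continuity is needed at the endpoint `x`, which may lie on the boundary.
  obtain ⟨c, hc1, hc2⟩ := exists_hasDerivAt_eq_slope (fun s : ℝ => v (y + s • h))
    (fun s => inner ℝ (G (y + s • h)) h) one_pos
    (hv.comp (by fun_prop) hcl) (fun s hs => hd1 s ⟨hs.1.le, hs.2⟩)
  obtain ⟨c', hc1', hc2'⟩ := exists_hasDerivAt_eq_slope
    (fun s : ℝ => inner ℝ (G (y + s • h)) h) (fun s => inner ℝ (H (y + s • h) h) h) hc1.1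
    (fun s hs => (hd2 s ⟨hs.1, hs.2.trans_lt hc1.2⟩).continuousAt.continuousWithinAt)
    (fun s hs => hd2 s ⟨hs.1.le, hs.2.trans hc1.2⟩)
  have hp := hpos _ (hmem c' ⟨hc1'.1.le, hc1'.2.trans hc1.2⟩) h h0
  have hcpos := hc1.1
  rw [hc2', lt_div_iff₀ (by linarith)] at hp
  have e1 : y + (1 : ℝ) • h = x := by rw [hh]; module
  simp only [zero_smul, add_zero, zero_mul, sub_zero, div_one, e1] at hc2 hp
  linarith

/-- On `D = {u < v}` the gradient map `G` is injective, and each of its values is a subgradient of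
`u` at some point of `D`. The area formula then gives `Λ' |D| ≤ |G(D)| ≤ Λ |D|`, which is absurd if
`D` is nonempty, since `D` is open and bounded. -/
theorem comparison_of_subsolution {n : ℕ} {Ω : Set (EuclideanSpace ℝ (Fin n))}
    (hΩ : IsOpen Ω) (hc : Convex ℝ Ω) (hb : Bornology.IsBounded Ω)
    {u v : EuclideanSpace ℝ (Fin n) → ℝ} {G : EuclideanSpace ℝ (Fin n) → EuclideanSpace ℝ (Fin n)}
    {H : EuclideanSpace ℝ (Fin n) → EuclideanSpace ℝ (Fin n) →L[ℝ] EuclideanSpace ℝ (Fin n)}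
    {Λ Λ' : ℝ} (hΛ' : Λ < Λ') (hΛ0 : 0 ≤ Λ)
    (hu : ContinuousOn u (closure Ω)) (hv : ContinuousOn v (closure Ω))
    (hMA : ∀ A, MeasurableSet A → A ⊆ Ω → mongeAmpereMeasure Ω u A ≤ ENNReal.ofReal Λ * volume A)
    (hG : ∀ y ∈ Ω, HasFDerivAt v (innerSL ℝ (G y)) y)
    (hH : ∀ y ∈ Ω, HasFDerivAt G (H y) y) (hpos : ∀ y ∈ Ω, ∀ h, h ≠ 0 → 0 < inner ℝ (H y h) h)
    (hdet : ∀ y ∈ Ω, Λ' ≤ (H y).det) (hbd : ∀ y ∈ frontier Ω, v y ≤ u y) :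
    ∀ y ∈ Ω, v y ≤ u y := by
  by_contra! hcon
  obtain ⟨y₀, hy₀, hlt⟩ := hcon
  set D := {y ∈ Ω | u y < v y} with hD
  have hDΩ : D ⊆ Ω := fun y hy => hy.1
  have hDo : IsOpen D := by
    have h1 : ContinuousOn (fun y => v y - u y) Ω := (hv.sub hu).mono subset_closure
    have := h1.isOpen_inter_preimage hΩ (isOpen_Ioi (a := (0 : ℝ)))
    convert this using 1
    ext y
    simp [hD]
  have hstrict := fun {x y} => strict_gradient_inequality hΩ hc hv hG hH hpos (x := x) (y := y)
  have hinj : InjOn G D := by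
    intro a ha b hb hab
    by_contra hne
    have h1 := hstrict (subset_closure ha.1) hb.1 hne
    have h2 := hstrict (subset_closure hb.1) ha.1 (Ne.symm hne)
    rw [hab, ← neg_sub a b, inner_neg_right] at h2
    linarith
  have hsub : G '' D ⊆ ⋃ x ∈ D, subdifferential Ω u x := by
    rintro _ ⟨y, hy, rfl⟩
    have hK : IsCompact (closure Ω) := hb.isCompact_closure
    -- Translate the tangent plane of `v` at `y` until it touches `u` from below, at `x`. It then
    -- lies below its original position by at least `v y - u y > 0`, while `v` lies above that
    -- position; hence `u x < v x`, which excludes the boundary.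
    obtain ⟨x, hx, hmin⟩ := hK.exists_isMinOn ⟨y, subset_closure hy.1⟩
      (f := fun x => u x - inner ℝ (G y) (x - y))
      (hu.sub (by fun_prop))
    rw [isMinOn_iff] at hmin
    have h1 := hmin y (subset_closure hy.1)
    simp only [sub_self, inner_zero_right, sub_zero] at h1
    have hxv : u x < v x := by
      rcases eq_or_ne x y with rfl | hne
      · exact hy.2
      · have := hstrict hx hy.1 hne
        linarith [hy.2]
    have hxΩ : x ∈ Ω := by
      by_contra hx'
      have : x ∈ frontier Ω := by rw [frontier, hΩ.interior_eq]; exact ⟨hx, hx'⟩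
      linarith [hbd x this]
    refine mem_iUnion₂.2 ⟨x, ⟨hxΩ, hxv⟩, fun w hw => ?_⟩
    have h2 := hmin w (subset_closure hw)
    have : inner ℝ (G y) (w - x) = inner ℝ (G y) (w - y) - inner ℝ (G y) (x - y) := by
      rw [← inner_sub_right]; congr 1; abel
    linarith
  have hvolpos : volume D ≠ 0 := (hDo.measure_pos volume ⟨y₀, hy₀, hlt⟩).ne'
  have hvolfin : volume D ≠ ⊤ := (hb.subset hDΩ).measure_lt_top.ne
  have hle : ENNReal.ofReal Λ' * volume D ≤ ENNReal.ofReal Λ * volume D := by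
    calc ENNReal.ofReal Λ' * volume D = ∫⁻ _ in D, ENNReal.ofReal Λ' := by simp
      _ ≤ ∫⁻ x in D, ENNReal.ofReal |(H x).det| :=
        setLIntegral_mono' hDo.measurableSet fun x hx =>
          ENNReal.ofReal_le_ofReal ((hdet x hx.1).trans (le_abs_self _))
      _ = volume (G '' D) := lintegral_abs_det_fderiv_eq_addHaar_image volume hDo.measurableSet
          (fun x hx => (hH x hx.1).hasFDerivWithinAt) hinj
      _ ≤ mongeAmpereMeasure Ω u D := measure_mono hsub
      _ ≤ _ := hMA D hDo.measurableSet hDΩ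
  have := (ENNReal.mul_le_mul_iff_left hvolpos hvolfin).1 hle
  rw [ENNReal.ofReal_le_ofReal_iff hΛ0] at this
  linarith

/-! ### The barrier and its Hessian. -/

section Barrier

variable {E : Type*} [NormedAddCommGroup E] [InnerProductSpace ℝ E]

/-- The component of `x` orthogonal to the unit vector `ν`. -/
noncomputable def orthPart (ν x : E) : E := x - inner ℝ ν x • ν

/-- The barrier `t ^ γ * (‖x'‖² - M)` on the half-space `t > 0`, where `t = ⟨ν, x⟩` and `x'` is the
component of `x` orthogonal to `ν`. -/
noncomputable def barrier (γ M : ℝ) (ν x : E) : ℝ :=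
  inner ℝ ν x ^ γ * (‖x‖ ^ 2 - inner ℝ ν x ^ 2 - M)

/-- The gradient of `barrier`. -/
noncomputable def barrierGrad (γ M : ℝ) (ν x : E) : E :=
  (γ * inner ℝ ν x ^ (γ - 1) * (‖x‖ ^ 2 - inner ℝ ν x ^ 2 - M)) • ν
    + (2 * inner ℝ ν x ^ γ) • orthPart ν x

/-- The map `x ↦ x + ⟨a, x⟩ b`. -/
noncomputable def rankOneShift (a b : E) : E →L[ℝ] E :=
  ContinuousLinearMap.id ℝ E + (innerSL ℝ a).smulRight b

@[simp] theorem rankOneShift_apply (a b x : E) : rankOneShift a b x = x + inner ℝ a x • b := rfl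

theorem det_rankOneShift [FiniteDimensional ℝ E] (a b : E) :
    (rankOneShift a b).det = 1 + inner ℝ a b :=
  LinearMap.transvection.det (innerSL ℝ a).toLinearMap b

/-- The factor of `barrierHess` in the direction `ν`. -/
noncomputable def barrierFactor (γ M : ℝ) (ν x : E) : ℝ :=
  (γ * (1 - γ) * (M - (‖x‖ ^ 2 - inner ℝ ν x ^ 2)) - 2 * γ ^ 2 * (‖x‖ ^ 2 - inner ℝ ν x ^ 2))
    / (2 * inner ℝ ν x ^ 2)

/-- The Hessian of `barrier`, in factorized form. -/
noncomputable def barrierHess (γ M : ℝ) (ν x : E) : E →L[ℝ] E :=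
  (2 * inner ℝ ν x ^ γ) •
    (rankOneShift ((γ / inner ℝ ν x) • orthPart ν x) ν ∘L
      (rankOneShift ((barrierFactor γ M ν x - 1) • ν) ν ∘L
        rankOneShift ν ((γ / inner ℝ ν x) • orthPart ν x)))

theorem inner_orthPart {ν : E} (hν : ‖ν‖ = 1) (x : E) : inner ℝ ν (orthPart ν x) = 0 := by
  simp [orthPart, inner_sub_right, inner_smul_right, hν]

theorem norm_orthPart_sq {ν : E} (hν : ‖ν‖ = 1) (x : E) :
    ‖orthPart ν x‖ ^ 2 = ‖x‖ ^ 2 - inner ℝ ν x ^ 2 := by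
  rw [orthPart, norm_sub_sq_real, inner_smul_right, norm_smul, hν, real_inner_comm ν x]
  simp only [Real.norm_eq_abs, mul_one, sq_abs]
  ring

theorem hasFDerivAt_inner_rpow {ν x : E} (hx : 0 < inner ℝ ν x) (γ : ℝ) :
    HasFDerivAt (fun y : E => inner ℝ ν y ^ γ)
      ((γ * inner ℝ ν x ^ (γ - 1)) • innerSL ℝ ν) x :=
  (innerSL ℝ ν).hasFDerivAt.rpow_const (Or.inl hx.ne')

theorem hasFDerivAt_norm_sq_sub (ν x : E) (M : ℝ) :
    HasFDerivAt (fun y : E => ‖y‖ ^ 2 - inner ℝ ν y ^ 2 - M)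
      ((2 : ℝ) • innerSL ℝ (orthPart ν x)) x := by
  have h1 : HasFDerivAt (fun y : E => ‖y‖ ^ 2) (2 • innerSL ℝ x) x :=
    (hasStrictFDerivAt_norm_sq x).hasFDerivAt
  have h2 : HasFDerivAt (fun y : E => inner ℝ ν y ^ 2) _ x := (innerSL ℝ ν).hasFDerivAt.pow 2
  refine ((h1.sub h2).sub_const M).congr_fderiv ?_
  ext h
  simp [orthPart]
  ring

theorem hasFDerivAt_barrier {ν x : E} (hx : 0 < inner ℝ ν x) (γ M : ℝ) :
    HasFDerivAt (barrier γ M ν) (innerSL ℝ (barrierGrad γ M ν x)) x := by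
  refine ((hasFDerivAt_inner_rpow hx γ).mul (hasFDerivAt_norm_sq_sub ν x M)).congr_fderiv ?_
  ext h
  simp [barrierGrad]
  ring

theorem hasFDerivAt_barrierGrad {ν x : E} (hν : ‖ν‖ = 1) (hx : 0 < inner ℝ ν x) (γ M : ℝ) :
    HasFDerivAt (barrierGrad γ M ν) (barrierHess γ M ν x) x := by
  have h1 := (((hasFDerivAt_inner_rpow hx (γ - 1)).const_mul γ).mul
    (hasFDerivAt_norm_sq_sub ν x M)).smul_const ν
  have h3 : HasFDerivAt (orthPart ν) _ x :=
    (hasFDerivAt_id x).sub ((innerSL ℝ ν).hasFDerivAt.smul_const ν)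
  have h2 := ((hasFDerivAt_inner_rpow hx γ).const_mul 2).smul h3
  refine (h1.add h2).congr_fderiv ?_
  ext h
  -- Writing all powers as `t ^ γ` over powers of `t` turns the comparison of coefficients into a
  -- rational identity.
  have e1 : inner ℝ ν x ^ (γ - 1) = inner ℝ ν x ^ γ / inner ℝ ν x := Real.rpow_sub_one hx.ne' γ
  have e2 : inner ℝ ν x ^ (γ - 1 - 1) = inner ℝ ν x ^ γ / inner ℝ ν x / inner ℝ ν x := by
    rw [Real.rpow_sub_one hx.ne', e1]
  have e3 := inner_orthPart hν x
  have e4 : inner ℝ (orthPart ν x) ν = 0 := by rw [real_inner_comm, e3]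
  have e5 : inner ℝ (orthPart ν x) (orthPart ν x) = ‖x‖ ^ 2 - inner ℝ ν x ^ 2 := by
    rw [real_inner_self_eq_norm_sq, norm_orthPart_sq hν]
  simp only [barrierHess, add_apply, smul_apply,
    ContinuousLinearMap.smulRight_apply, innerSL_apply_apply, ContinuousLinearMap.comp_apply,
    rankOneShift_apply, inner_add_right, inner_smul_right, inner_smul_left, e1, e2, e3, e4, e5,
    sub_apply, ContinuousLinearMap.id_apply,
    smul_eq_mul, barrierFactor, conj_trivial]
  have := hx.ne'
  match_scalars <;> field_simp <;> ring

/-- Completing the square: the outer factors of `barrierHess` are adjoint to each other, so after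
the shear `h ↦ k` the quadratic form is diagonal, with weight `1` orthogonal to `ν` and weight
`barrierFactor` (a Schur complement divided by `2 t ^ γ`) along `ν`. -/
theorem inner_barrierHess_pos {ν x : E} (hν : ‖ν‖ = 1) (hx : 0 < inner ℝ ν x) {γ M : ℝ}
    (hM : 0 < barrierFactor γ M ν x) {h : E} (hh : h ≠ 0) :
    0 < inner ℝ (barrierHess γ M ν x h) h := by
  set s := γ / inner ℝ ν x
  set k := rankOneShift ν (s • orthPart ν x) h with hk
  have hkν : inner ℝ ν k = inner ℝ ν h := by
    simp [hk, inner_add_right, inner_smul_right, inner_orthPart hν]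
  have key : inner ℝ (barrierHess γ M ν x h) h = (2 * inner ℝ ν x ^ γ) *
      (‖k‖ ^ 2 - inner ℝ ν k ^ 2 + barrierFactor γ M ν x * inner ℝ ν k ^ 2) := by
    have e4 : inner ℝ (orthPart ν x) ν = 0 := by rw [real_inner_comm, inner_orthPart hν]
    have hkk : ‖k‖ ^ 2 = inner ℝ k h + inner ℝ ν h * (s * inner ℝ (orthPart ν x) k) := by
      rw [← real_inner_self_eq_norm_sq]
      nth_rewrite 2 [hk]
      simp only [rankOneShift_apply, inner_add_right, inner_smul_right,
        real_inner_comm (orthPart ν x) k]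
    simp only [barrierHess, smul_apply, ContinuousLinearMap.comp_apply]
    rw [← hk]
    simp only [rankOneShift_apply, inner_smul_left, inner_add_left, inner_add_right,
      inner_smul_right, hkν, hkk, e4, conj_trivial]
    ring
  have h1 : inner ℝ ν k ^ 2 ≤ ‖k‖ ^ 2 := by
    have := norm_orthPart_sq hν k
    nlinarith [sq_nonneg ‖orthPart ν k‖]
  rw [key]
  have hT : 0 < inner ℝ ν x ^ γ := Real.rpow_pos_of_pos hx γ
  refine mul_pos (by positivity) ?_
  rcases eq_or_ne (inner ℝ ν h) 0 with h0 | h0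
  · have : k = h := by simp [hk, h0]
    rw [hkν, h0, this]
    have := norm_pos_iff.2 hh
    simp only [ne_eq, OfNat.ofNat_ne_zero, not_false_eq_true, zero_pow, sub_zero, mul_zero, add_zero]
    positivity
  · rw [hkν] at h1 ⊢
    have : 0 < inner ℝ ν h ^ 2 := by positivity
    have := mul_pos hM this
    linarith

/-- The two outer shears have determinant `1` because `orthPart ν x` is orthogonal to `ν`; only the
scaling along `ν` and the scalar prefactor contribute. -/
theorem det_barrierHess [FiniteDimensional ℝ E] {ν : E} (hν : ‖ν‖ = 1) (x : E) (γ M : ℝ) :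
    (barrierHess γ M ν x).det =
      (2 * inner ℝ ν x ^ γ) ^ Module.finrank ℝ E * barrierFactor γ M ν x := by
  have e4 : inner ℝ (orthPart ν x) ν = 0 := by rw [real_inner_comm, inner_orthPart hν]
  have h1 := det_rankOneShift ((γ / inner ℝ ν x) • orthPart ν x) ν
  have h2 := det_rankOneShift ((barrierFactor γ M ν x - 1) • ν) ν
  have h3 := det_rankOneShift ν ((γ / inner ℝ ν x) • orthPart ν x)
  simp only [inner_smul_left, inner_smul_right, e4, inner_orthPart hν, real_inner_self_eq_norm_sq,
    hν] at h1 h2 h3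
  simp only [ContinuousLinearMap.det, barrierHess, ContinuousLinearMap.toLinearMap_smul, LinearMap.det_smul,
    ContinuousLinearMap.toLinearMap_comp, LinearMap.det_comp] at h1 h2 h3 ⊢
  rw [h1, h2, h3]
  simp

end Barrier

theorem barrier_nonpos {E : Type*} [NormedAddCommGroup E] [InnerProductSpace ℝ E] {γ M : ℝ}
    {ν x : E} (hx : 0 ≤ inner ℝ ν x) (hM : ‖x‖ ^ 2 ≤ M) : barrier γ M ν x ≤ 0 :=
  mul_nonpos_of_nonneg_of_nonpos (Real.rpow_nonneg hx γ)
    (by nlinarith [sq_nonneg (inner ℝ ν x)])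

theorem neg_mul_norm_rpow_le_barrier {E : Type*} [NormedAddCommGroup E] [InnerProductSpace ℝ E]
    {γ M : ℝ} (hγ : 0 ≤ γ) (hM : 0 ≤ M) {ν x : E} (hν : ‖ν‖ = 1) (hx : 0 ≤ inner ℝ ν x) :
    -(M * ‖x‖ ^ γ) ≤ barrier γ M ν x := by
  have h1 : inner ℝ ν x ≤ ‖x‖ := by simpa [hν] using real_inner_le_norm ν x
  have h2 : inner ℝ ν x ^ γ ≤ ‖x‖ ^ γ := Real.rpow_le_rpow hx h1 hγ
  have h3 := Real.rpow_nonneg hx γ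
  have h4 : 0 ≤ ‖x‖ ^ 2 - inner ℝ ν x ^ 2 := by nlinarith
  rw [barrier]
  nlinarith [mul_nonneg h3 h4, mul_le_mul_of_nonneg_left h2 hM]

/-! ### Lower bound for the solution near the boundary. -/

/-- A supporting half-space of an open convex set at a point outside of it. -/
theorem exists_unit_inner_pos {E : Type*} [NormedAddCommGroup E] [InnerProductSpace ℝ E]
    [CompleteSpace E] {Ω : Set E} (hΩ : IsOpen Ω) (hc : Convex ℝ Ω) (hne : Ω.Nonempty) {z : E}
    (hz : z ∉ Ω) : ∃ ν : E, ‖ν‖ = 1 ∧ ∀ y ∈ Ω, 0 < inner ℝ ν (y - z) := by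
  obtain ⟨l, hl⟩ := geometric_hahn_banach_open_point hc hΩ hz
  set ξ := (InnerProductSpace.toDual ℝ E).symm l with hξ
  have hin : ∀ y, inner ℝ ξ y = l y := fun y => InnerProductSpace.toDual_symm_apply
  have hpos : ∀ y ∈ Ω, 0 < inner ℝ (-ξ) (y - z) := fun y hy => by
    rw [inner_neg_left, hin, map_sub]
    linarith [hl y hy]
  have h0 : ξ ≠ 0 := by
    rintro h
    obtain ⟨y, hy⟩ := hne
    simpa [h] using hpos y hy
  have hn : 0 < ‖ξ‖ := norm_pos_iff.2 h0
  refine ⟨‖ξ‖⁻¹ • (-ξ), ?_, fun y hy => ?_⟩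
  · rw [norm_smul, norm_neg, norm_inv, norm_norm, inv_mul_cancel₀ hn.ne']
  · rw [inner_smul_left]
    exact mul_pos (by simpa using hn) (hpos y hy)

theorem inner_nonneg_of_mem_closure {E : Type*} [NormedAddCommGroup E] [InnerProductSpace ℝ E]
    {Ω : Set E} {ν z : E} (h : ∀ y ∈ Ω, 0 < inner ℝ ν (y - z)) {y : E} (hy : y ∈ closure Ω) :
    0 ≤ inner ℝ ν (y - z) := by
  have hcl : IsClosed {y : E | 0 ≤ inner ℝ ν (y - z)} :=
    isClosed_le continuous_const (by fun_prop)
  exact closure_minimal (fun w hw => (h w hw).le) hcl hy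

theorem dist_le_two_mul_of_mem_closure {E : Type*} [NormedAddCommGroup E] {Ω : Set E} {R : ℝ}
    (hR : Ω ⊆ Metric.ball 0 R) {x y : E} (hx : x ∈ closure Ω) (hy : y ∈ closure Ω) :
    dist x y ≤ 2 * R := by
  have h : closure Ω ⊆ Metric.closedBall 0 R :=
    closure_minimal (hR.trans Metric.ball_subset_closedBall) Metric.isClosed_closedBall
  have h1 := h hx
  have h2 := h hy
  rw [Metric.mem_closedBall] at h1 h2
  linarith [dist_triangle_right x y 0]

theorem IsAlexandrovSolution.measure_le {n : ℕ} {Ω : Set (EuclideanSpace ℝ (Fin n))}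
    {f g u : EuclideanSpace ℝ (Fin n) → ℝ} {Λ : ℝ}
    (hsol : IsAlexandrovSolution Ω f g u)
    (hf : ∀ᵐ x ∂volume.restrict Ω, f x ≤ Λ) {A : Set (EuclideanSpace ℝ (Fin n))}
    (hA : MeasurableSet A) (hAΩ : A ⊆ Ω) :
    mongeAmpereMeasure Ω u A ≤ ENNReal.ofReal Λ * volume A := by
  rw [hsol.measure_eq A hA hAΩ]
  calc ∫⁻ x in A, ENNReal.ofReal (f x) ≤ ∫⁻ _ in A, ENNReal.ofReal Λ := by
        refine lintegral_mono_ae ?_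
        filter_upwards [ae_restrict_of_ae_restrict_of_subset hAΩ hf] with x hx
        exact ENNReal.ofReal_le_ofReal hx
    _ = _ := by simp

/-- Lower bound for the determinant of the Hessian of a multiple of the barrier. -/
theorem le_det_smul_barrierHess {n : ℕ} (hn : 1 ≤ n) {R Λ γ M k : ℝ}
    (hγn : γ * n ≤ 2) (hk : 1 ≤ k)
    (hk' : Λ ≤ k * (2 * R) ^ (γ * n - 2))
    {ν x : EuclideanSpace ℝ (Fin n)} (hν : ‖ν‖ = 1) (hx : 0 < inner ℝ ν x) (hxR : ‖x‖ ≤ 2 * R)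
    (hM : 1 / inner ℝ ν x ^ 2 ≤ barrierFactor γ M ν x) :
    Λ ≤ (k • barrierHess γ M ν x).det := by
  set t := inner ℝ ν x with ht
  have h1 : t ≤ 2 * R := le_trans (by simpa [hν] using real_inner_le_norm ν x) hxR
  have hdet : (k • barrierHess γ M ν x).det = k ^ n * ((2 * t ^ γ) ^ n * barrierFactor γ M ν x) := by
    rw [ContinuousLinearMap.det, ContinuousLinearMap.toLinearMap_smul, LinearMap.det_smul]
    have := det_barrierHess hν x γ M
    rw [ContinuousLinearMap.det] at this
    rw [this, finrank_euclideanSpace_fin]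
  -- This is where `γ ≤ 2 / n` enters: the exponent is nonpositive, so the power is smallest at the
  -- largest `t`.
  have h2 : (2 * R) ^ (γ * n - 2) ≤ t ^ (γ * n - 2) :=
    Real.rpow_le_rpow_of_nonpos hx h1 (by linarith)
  have h3 : t ^ (γ * n - 2) = (t ^ γ) ^ n * (1 / t ^ 2) := by
    rw [Real.rpow_sub hx, Real.rpow_mul_natCast hx.le, Real.rpow_ofNat, mul_one_div]
  have htγ : 0 < t ^ γ := Real.rpow_pos_of_pos hx γ
  have h4 : (t ^ γ) ^ n ≤ (2 * t ^ γ) ^ n := by gcongr; linarith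
  have h5 : k ≤ k ^ n := le_self_pow₀ hk (by lia)
  rw [hdet]
  calc Λ ≤ k * (2 * R) ^ (γ * n - 2) := hk'
    _ ≤ k ^ n * ((t ^ γ) ^ n * (1 / t ^ 2)) := by
      rw [← h3]
      have : 0 ≤ (2 * R) ^ (γ * n - 2) := Real.rpow_nonneg (hx.le.trans h1) _
      gcongr
    _ ≤ _ := by gcongr

/-- The solution of the Dirichlet problem lies above the boundary datum up to a power of the
distance to the boundary. -/
theorem exists_boundary_lower_bound {n : ℕ} (hn : 1 ≤ n) {R Λ γ : ℝ} (hR : 0 < R) (hΛ : 0 ≤ Λ)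
    (hγ0 : 0 < γ) (hγ1 : γ < 1) (hγn : γ * n ≤ 2) :
    ∃ C : ℝ, 0 ≤ C ∧ ∀ (Ω : Set (EuclideanSpace ℝ (Fin n))) (f g u : EuclideanSpace ℝ (Fin n) → ℝ),
      IsOpen Ω → Convex ℝ Ω → Ω ⊆ Metric.ball 0 R → (∀ᵐ x ∂volume.restrict Ω, f x ≤ Λ) →
      ConvexOn ℝ (closure Ω) g → ContinuousOn g (closure Ω) → IsAlexandrovSolution Ω f g u →
      ∀ x ∈ Ω, ∀ z ∈ frontier Ω, g x - C * dist x z ^ γ ≤ u x := by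
  have hγγ : 0 < γ * (1 - γ) := mul_pos hγ0 (by linarith)
  -- Chosen so that the numerator of `barrierFactor` is at least `2` whenever the squared orthogonal
  -- part is at most `4 R²`; the factor is then at least `1 / t²`. This needs `γ < 1`.
  set M := 4 * R ^ 2 + (8 * γ ^ 2 * R ^ 2 + 2) / (γ * (1 - γ)) with hM
  have hM' : γ * (1 - γ) * (M - 4 * R ^ 2) = 8 * γ ^ 2 * R ^ 2 + 2 := by
    rw [hM, add_sub_cancel_left, mul_div_cancel₀ _ hγγ.ne']
  have hMR : 4 * R ^ 2 ≤ M := by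
    rw [hM]; have : 0 ≤ (8 * γ ^ 2 * R ^ 2 + 2) / (γ * (1 - γ)) := by positivity
    linarith
  have hM0 : 0 ≤ M := le_trans (by positivity) hMR
  have hc0 : 0 < (2 * R) ^ (γ * n - 2) := Real.rpow_pos_of_pos (by linarith) _
  -- The multiple `k` pushes the determinant up to `Λ + 1`, since comparison requires a strict gap
  -- above `Λ`.
  set k := 1 + (Λ + 1) / (2 * R) ^ (γ * n - 2) with hk
  have hk1 : 1 ≤ k := by
    rw [hk]; have : 0 ≤ (Λ + 1) / (2 * R) ^ (γ * n - 2) := by positivity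
    linarith
  have hk' : Λ + 1 ≤ k * (2 * R) ^ (γ * n - 2) := by
    rw [hk, add_mul, div_mul_cancel₀ _ hc0.ne']; linarith
  have hk0 : 0 < k := by linarith
  refine ⟨k * M, by positivity, ?_⟩
  intro Ω f g u hΩ hc hΩR hf hg hgc hsol x hx z hz
  have hzcl : z ∈ closure Ω := frontier_subset_closure hz
  have hzΩ : z ∉ Ω := by
    rw [frontier, hΩ.interior_eq] at hz; exact hz.2
  obtain ⟨ν, hν, hνpos⟩ := exists_unit_inner_pos hΩ hc ⟨x, hx⟩ hzΩ
  have hnorm : ∀ y ∈ closure Ω, ‖y - z‖ ≤ 2 * R := fun y hy => by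
    rw [← dist_eq_norm]; exact dist_le_two_mul_of_mem_closure hΩR hy hzcl
  have hnorm2 : ∀ y ∈ closure Ω, ‖y - z‖ ^ 2 ≤ 4 * R ^ 2 := fun y hy => by
    have := hnorm y hy
    have := norm_nonneg (y - z)
    nlinarith
  have hfac : ∀ y ∈ Ω, 1 / inner ℝ ν (y - z) ^ 2 ≤ barrierFactor γ M ν (y - z) := by
    intro y hy
    have h1 := hνpos y hy
    have h2 : ‖y - z‖ ^ 2 - inner ℝ ν (y - z) ^ 2 ≤ 4 * R ^ 2 := by
      nlinarith [hnorm2 y (subset_closure hy)]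
    set q := ‖y - z‖ ^ 2 - inner ℝ ν (y - z) ^ 2 with hq
    have h3 : 2 ≤ γ * (1 - γ) * (M - q) - 2 * γ ^ 2 * q := by
      nlinarith [mul_le_mul_of_nonneg_left h2 hγγ.le,
        mul_le_mul_of_nonneg_left h2 (sq_nonneg γ)]
    rw [barrierFactor, div_le_div_iff₀ (by positivity) (by positivity)]
    nlinarith [sq_nonneg (inner ℝ ν (y - z))]
  have hfac0 : ∀ y ∈ Ω, 0 < barrierFactor γ M ν (y - z) := fun y hy =>
    lt_of_lt_of_le (by have := hνpos y hy; positivity) (hfac y hy)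
  have key : ∀ a < g x, a - k * M * dist x z ^ γ ≤ u x := by
    intro a ha
    -- The affine minorant is adapted to `x`, the barrier to `z`. Adding the affine function does
    -- not change the Hessian, and on the boundary the sum is at most `g = u` because the barrier is
    -- nonpositive there.
    obtain ⟨l, c, hl1, hl2⟩ := hg.exists_affine_le_of_lt (𝕜 := ℝ) (subset_closure hx) ha
      isClosed_closure hgc.lowerSemicontinuousOn
    have hl : ∀ y ∈ closure Ω, l y + c ≤ g y := fun y hy => hl1 ⟨y, hy⟩
    replace hl2 : l x + c = a := hl2
    have hcomp := comparison_of_subsolution hΩ hc (Metric.isBounded_ball.subset hΩR)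
      (u := u) (v := fun y => l y + c + k * barrier γ M ν (y - z))
      (G := fun y => (InnerProductSpace.toDual ℝ _).symm l + k • barrierGrad γ M ν (y - z))
      (H := fun y => k • barrierHess γ M ν (y - z)) (lt_add_one Λ) hΛ hsol.continuousOn
      ?_ (fun A hA hAΩ => hsol.measure_le hf hA hAΩ) ?_ ?_ ?_ ?_ ?_ x hx
    · have h1 := neg_mul_norm_rpow_le_barrier hγ0.le hM0 hν (hνpos x hx).le
      rw [← dist_eq_norm] at h1
      have := mul_le_mul_of_nonneg_left h1 hk0.le
      simp only [hl2] at hcomp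
      linarith
    · refine (Continuous.continuousOn ?_)
      unfold barrier
      have : Continuous fun y : EuclideanSpace ℝ (Fin n) => inner ℝ ν (y - z) ^ γ :=
        Continuous.rpow_const (by fun_prop) (fun _ => Or.inr hγ0.le)
      fun_prop
    · intro y hy
      have h1 := (hasFDerivAt_barrier (hνpos y hy) γ M).comp y ((hasFDerivAt_id y).sub_const z)
      refine ((l.hasFDerivAt.add_const c).add (h1.const_mul k)).congr_fderiv ?_
      ext h
      simp
    · intro y hy
      have h1 := (hasFDerivAt_barrierGrad hν (hνpos y hy) γ M).comp y
        ((hasFDerivAt_id y).sub_const z)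
      refine ((h1.const_smul k).const_add _).congr_fderiv ?_
      ext h
      simp
    · intro y hy h hh
      rw [smul_apply, inner_smul_left]
      exact mul_pos (by simpa using hk0)
        (inner_barrierHess_pos hν (hνpos y hy) (hfac0 y hy) hh)
    · intro y hy
      exact le_det_smul_barrierHess hn hγn hk1 hk' hν (hνpos y hy)
        (hnorm y (subset_closure hy)) (hfac y hy)
    · intro y hy
      have hycl := frontier_subset_closure hy
      rw [hsol.boundary_eq y hy]
      have := barrier_nonpos (γ := γ) (inner_nonneg_of_mem_closure hνpos hycl)
        ((hnorm2 y hycl).trans hMR)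
      nlinarith [hl y hycl]
  refine sub_le_iff_le_add.2 (le_of_forall_lt_imp_le_of_dense fun a ha => ?_)
  linarith [key a ha]

/-! ### Pointwise bound on subgradients. -/

/-- A ray missing the frontier is a connected subset of the interior and the exterior together;
starting inside, it would stay inside, contradicting boundedness. -/
theorem exists_add_smul_mem_frontier {E : Type*} [NormedAddCommGroup E] [NormedSpace ℝ E]
    {Ω : Set E} (hb : Bornology.IsBounded Ω) {x e : E} (hx : x ∈ Ω) (he : ‖e‖ = 1) :
    ∃ s : ℝ, 0 ≤ s ∧ x + s • e ∈ frontier Ω := by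
  obtain ⟨r, hr⟩ := hb.subset_ball 0
  have hline : Continuous fun s : ℝ => x + s • e := by fun_prop
  have hA : IsPreconnected ((fun s : ℝ => x + s • e) '' Ici 0) :=
    (convex_Ici (0 : ℝ)).isPreconnected.image _ hline.continuousOn
  by_contra! hcon
  have hsub : (fun s : ℝ => x + s • e) '' Ici 0 ⊆ interior Ω := by
    refine hA.subset_left_of_subset_union isOpen_interior
      (isClosed_closure (s := Ω)).isOpen_compl ?_ ?_ ?_
    · exact disjoint_compl_right.mono_left interior_subset_closure
    · rintro _ ⟨s, hs, rfl⟩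
      have h1 := hcon s hs
      by_cases h2 : x + s • e ∈ closure Ω
      · left
        by_contra h3
        exact h1 ⟨h2, h3⟩
      · right; exact h2
    · refine ⟨x, ⟨0, by simp, by simp⟩, ?_⟩
      by_contra h3
      exact hcon 0 le_rfl (by simpa using ⟨subset_closure hx, h3⟩)
  have h1 := hr (interior_subset (hsub ⟨‖x‖ + |r|, by simp only [mem_Ici]; positivity, rfl⟩))
  rw [mem_ball_zero_iff] at h1
  have h2 := norm_sub_le_norm_add ((‖x‖ + |r|) • e) x
  rw [norm_smul, he, mul_one, Real.norm_of_nonneg (by positivity), add_comm _ x] at h2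
  linarith [le_abs_self r]

theorem exists_subgradient_bound {n : ℕ} (hn : 1 ≤ n) {R Λ γ K : ℝ} (hR : 0 < R) (hΛ : 0 ≤ Λ)
    (hγ0 : 0 < γ) (hγ1 : γ < 1) (hγn : γ * n ≤ 2) (hK : 0 ≤ K) :
    ∃ C : ℝ, 0 ≤ C ∧ ∀ (Ω : Set (EuclideanSpace ℝ (Fin n))) (f g u : EuclideanSpace ℝ (Fin n) → ℝ),
      IsOpen Ω → Convex ℝ Ω → Ω ⊆ Metric.ball 0 R → (∀ᵐ x ∂volume.restrict Ω, f x ≤ Λ) →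
      ConvexOn ℝ (closure Ω) g → ContinuousOn g (closure Ω) → IsAlexandrovSolution Ω f g u →
      (∀ x ∈ closure Ω, ∀ y ∈ closure Ω, |g x - g y| ≤ K * dist x y ^ γ) →
      ∀ x ∈ Ω, ∀ ξ ∈ subdifferential Ω u x,
        ‖ξ‖ ≤ C * Metric.infDist x (frontier Ω) ^ (γ - 1) := by
  obtain ⟨C, hC, hbound⟩ := exists_boundary_lower_bound hn hR hΛ hγ0 hγ1 hγn
  refine ⟨K + C, by positivity, ?_⟩
  intro Ω f g u hΩ hc hΩR hf hg hgc hsol hgK x hx ξ hξ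
  rcases eq_or_ne ξ 0 with rfl | hξ0
  · simp only [norm_zero]
    have := Metric.infDist_nonneg (x := x) (s := frontier Ω)
    positivity
  have hn : 0 < ‖ξ‖ := norm_pos_iff.2 hξ0
  -- Moving in the direction of `ξ` itself makes the supporting affine function grow at the full
  -- rate `‖ξ‖`.
  obtain ⟨s, hs, hz⟩ := exists_add_smul_mem_frontier (Metric.isBounded_ball.subset hΩR) hx
    (e := ‖ξ‖⁻¹ • ξ) (by rw [norm_smul, norm_inv, norm_norm, inv_mul_cancel₀ hn.ne'])
  set z := x + s • ‖ξ‖⁻¹ • ξ with hzdef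
  have hdist : dist x z = s := by
    rw [hzdef, dist_self_add_right, norm_smul, norm_smul, norm_inv, norm_norm,
      inv_mul_cancel₀ hn.ne', mul_one, Real.norm_of_nonneg hs]
  have hdpos : 0 < Metric.infDist x (frontier Ω) := by
    rw [← isClosed_frontier.notMem_iff_infDist_pos ⟨z, hz⟩]
    exact fun h => hΩ.inter_frontier_eq.subset ⟨hx, h⟩
  have hds : Metric.infDist x (frontier Ω) ≤ s := hdist ▸ Metric.infDist_le_dist_of_mem hz
  have hspos : 0 < s := hdpos.trans_le hds
  -- Subgradients are tested only inside `Ω`; continuity extends the inequality to the boundary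
  -- point `z`.
  have hsubcl : ∀ y ∈ closure Ω, u x + inner ℝ ξ (y - x) ≤ u y := by
    intro y hy
    exact le_on_closure (f := fun y => u x + inner ℝ ξ (y - x)) hξ (by fun_prop)
      hsol.continuousOn hy
  have h1 := hsubcl z (frontier_subset_closure hz)
  have h2 : inner ℝ ξ (z - x) = s * ‖ξ‖ := by
    rw [hzdef, add_sub_cancel_left, inner_smul_right, inner_smul_right,
      real_inner_self_eq_norm_sq]
    field_simp
  have h3 := hbound Ω f g u hΩ hc hΩR hf hg hgc hsol x hx z hz
  have h4 := (abs_le.1 (hgK z (frontier_subset_closure hz) x (subset_closure hx))).2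
  rw [dist_comm, hdist] at h4
  rw [hdist] at h3
  rw [h2, hsol.boundary_eq z hz] at h1
  have h5 : s * ‖ξ‖ ≤ (K + C) * s ^ γ := by linarith
  have h6 : ‖ξ‖ ≤ (K + C) * s ^ (γ - 1) := by
    rw [Real.rpow_sub_one hspos.ne', ← mul_div_assoc, le_div_iff₀ hspos]
    linarith
  refine h6.trans ?_
  have := Real.rpow_le_rpow_of_nonpos hdpos hds (by linarith : γ - 1 ≤ 0)
  gcongr

/-! ### Volume of boundary layers and integrability of powers of the distance. -/

/-- The set of points of a bounded convex set which leave it under a small translation is small. -/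
theorem volume_sdiff_translate_le {n : ℕ} {R s : ℝ} (hR : 0 < R) (hs : 0 < s)
    {Ω : Set (EuclideanSpace ℝ (Fin n))} (hΩ : IsOpen Ω) (hc : Convex ℝ Ω)
    (hΩR : Ω ⊆ Metric.ball 0 R) {e : EuclideanSpace ℝ (Fin n)} (he : ‖e‖ = 1) :
    volume {x ∈ Ω | x + s • e ∉ Ω} ≤
      ENNReal.ofReal (s / R) * volume (Metric.ball (0 : EuclideanSpace ℝ (Fin n)) (2 * R)) := by
  set A := {x ∈ Ω | x + s • e ∉ Ω} with hA
  have hAm : MeasurableSet A :=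
    hΩ.measurableSet.inter ((hΩ.preimage (continuous_add_const (s • e))).measurableSet.compl)
  -- By convexity a point that has left `Ω` along the ray cannot re-enter. Hence the translates of
  -- `A` by multiples of `s • e` are disjoint, and `⌈R / s⌉` of them fit into the ball of radius `2
  -- R`.
  have hout : ∀ x ∈ A, ∀ j : ℕ, 1 ≤ j → x + (j * s) • e ∉ Ω := by
    intro x hx j hj hmem
    refine hx.2 ?_
    have hj' : (1 : ℝ) ≤ j := by exact_mod_cast hj
    have := hc.add_smul_mem hx.1 hmem (t := (j : ℝ)⁻¹) ⟨by positivity, inv_le_one_of_one_le₀ hj'⟩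
    rwa [smul_smul, ← mul_assoc, inv_mul_cancel₀ (by positivity), one_mul] at this
  set N := ⌈R / s⌉₊ with hN
  set T : ℕ → Set (EuclideanSpace ℝ (Fin n)) := fun j => (fun x => x + (-(j * s)) • e) ⁻¹' A with hT
  have hTm : ∀ j, MeasurableSet (T j) := fun j => (measurable_add_const _) hAm
  have hTvol : ∀ j, volume (T j) = volume A := fun j => measure_preimage_add_right _ _ _
  have hTdisj : ∀ i j, i < j → Disjoint (T i) (T j) := by
    intro i j hij
    rw [Set.disjoint_left]
    intro x hi hj
    refine hout _ hj (j - i) (by lia) ?_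
    have : x + (-(j * s)) • e + (((j - i : ℕ) : ℝ) * s) • e = x + (-(i * s)) • e := by
      rw [Nat.cast_sub hij.le]; module
    rw [this]
    exact hi.1
  have hTsub : ∀ j ∈ Finset.range N, T j ⊆ Metric.ball 0 (2 * R) := by
    intro j hj x hx
    have h1 := hΩR hx.1
    have h2 : (j : ℝ) < R / s := Nat.lt_ceil.1 (Finset.mem_range.1 hj)
    rw [lt_div_iff₀ hs] at h2
    rw [mem_ball_zero_iff] at h1 ⊢
    have h3 : ‖x‖ ≤ ‖x + (-(j * s)) • e‖ + ‖((j : ℝ) * s) • e‖ := by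
      have := norm_add_le (x + (-(j * s)) • e) (((j : ℝ) * s) • e)
      simpa only [neg_smul, neg_add_cancel_right] using this
    rw [norm_smul, he, mul_one, Real.norm_of_nonneg (by positivity)] at h3
    linarith
  have hsum : N * volume A ≤ volume (Metric.ball (0 : EuclideanSpace ℝ (Fin n)) (2 * R)) := by
    calc (N : ℝ≥0∞) * volume A = ∑ j ∈ Finset.range N, volume (T j) := by simp [hTvol]
      _ = volume (⋃ j ∈ Finset.range N, T j) := by
        refine (measure_biUnion_finset ?_ fun j _ => hTm j).symm
        intro i _ j _ hij
        rcases hij.lt_or_gt with h | h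
        · exact hTdisj i j h
        · exact (hTdisj j i h).symm
      _ ≤ _ := measure_mono (iUnion₂_subset hTsub)
  calc volume A = ENNReal.ofReal (s / R) * (ENNReal.ofReal (R / s) * volume A) := by
        rw [← mul_assoc, ← ENNReal.ofReal_mul (by positivity), div_mul_div_cancel₀ hR.ne',
          div_self hs.ne', ENNReal.ofReal_one, one_mul]
    _ ≤ ENNReal.ofReal (s / R) * (N * volume A) := by
        gcongr
        rw [ENNReal.ofReal_le_iff_le_toReal (by simp)]
        simpa using Nat.le_ceil (R / s)
    _ ≤ _ := by gcongr

/-- The points of a bounded convex set within distance `t` of its boundary. -/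
theorem volume_infDist_lt_le {n : ℕ} (hn : 1 ≤ n) {R t : ℝ} (hR : 0 < R) (ht : 0 < t)
    {Ω : Set (EuclideanSpace ℝ (Fin n))} (hΩ : IsOpen Ω) (hc : Convex ℝ Ω)
    (hΩR : Ω ⊆ Metric.ball 0 R) :
    volume {x ∈ Ω | Metric.infDist x (frontier Ω) < t} ≤
      ENNReal.ofReal (2 * n * (n * t / R)) *
        volume (Metric.ball (0 : EuclideanSpace ℝ (Fin n)) (2 * R)) := by
  have hn' : (1 : ℝ) ≤ n := by exact_mod_cast hn
  set e : Fin n → EuclideanSpace ℝ (Fin n) := fun i => EuclideanSpace.single i 1 with he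
  have he1 : ∀ i, ‖e i‖ = 1 := fun i => by simp [he]
  -- A supporting normal `ν` at a nearby boundary point `z` has a coordinate of size at least `1 /
  -- n`. A step of length `n t` along that axis, with the right sign, lowers `⟨ν, x - z⟩ < t` by at
  -- least `t` and so leaves `Ω`. The `2 n` signed axes account for the constant.
  have hsub : {x ∈ Ω | Metric.infDist x (frontier Ω) < t} ⊆
      ⋃ i : Fin n, {x ∈ Ω | x + (n * t) • e i ∉ Ω} ∪ {x ∈ Ω | x + (n * t) • (-e i) ∉ Ω} := by
    rintro x ⟨hx, hxt⟩
    have : Nonempty (Fin n) := ⟨⟨0, by lia⟩⟩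
    obtain ⟨w, _, hw⟩ := exists_add_smul_mem_frontier (Metric.isBounded_ball.subset hΩR) hx
      (he1 (Classical.arbitrary _))
    obtain ⟨z, hz, hxz⟩ := (Metric.infDist_lt_iff ⟨_, hw⟩).1 hxt
    have hzΩ : z ∉ Ω := by
      rw [frontier, hΩ.interior_eq] at hz; exact hz.2
    obtain ⟨ν, hν, hνpos⟩ := exists_unit_inner_pos hΩ hc ⟨x, hx⟩ hzΩ
    have h1 : inner ℝ ν (x - z) < t := by
      have := real_inner_le_norm ν (x - z)
      rw [hν, one_mul, ← dist_eq_norm] at this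
      linarith
    obtain ⟨i, hi⟩ : ∃ i, 1 / (n : ℝ) ≤ ν i ^ 2 := by
      by_contra! hcon
      have h2 : ∑ i, ν i ^ 2 < ∑ _i : Fin n, 1 / (n : ℝ) :=
        Finset.sum_lt_sum_of_nonempty Finset.univ_nonempty fun i _ => hcon i
      rw [← EuclideanSpace.real_norm_sq_eq, hν] at h2
      simp at h2
      rw [mul_inv_cancel₀ (by positivity)] at h2
      exact lt_irrefl _ h2
    have habs : |ν i| ≤ 1 := by
      have := PiLp.norm_apply_le ν i
      rwa [hν] at this
    -- Since `|ν i| ≤ 1`, the square is at most the absolute value; this avoids `√n`.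
    have hi' : 1 / (n : ℝ) ≤ |ν i| := by
      rw [← sq_abs] at hi
      nlinarith [abs_nonneg (ν i)]
    rw [div_le_iff₀ (by positivity)] at hi'
    have hin : inner ℝ ν (e i) = ν i := by simp [he, EuclideanSpace.inner_single_right]
    refine mem_iUnion.2 ⟨i, ?_⟩
    rcases le_total 0 (ν i) with h0 | h0
    · right
      refine ⟨hx, fun hmem => ?_⟩
      have h3 := hνpos _ hmem
      rw [abs_of_nonneg h0] at hi'
      rw [add_sub_right_comm, inner_add_right, inner_smul_right, inner_neg_right, hin] at h3
      nlinarith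
    · left
      refine ⟨hx, fun hmem => ?_⟩
      have h3 := hνpos _ hmem
      rw [abs_of_nonpos h0] at hi'
      rw [add_sub_right_comm, inner_add_right, inner_smul_right, hin] at h3
      nlinarith
  have hs : 0 < n * t := by positivity
  set V := volume (Metric.ball (0 : EuclideanSpace ℝ (Fin n)) (2 * R))
  calc _ ≤ ∑ i : Fin n, volume ({x ∈ Ω | x + (n * t) • e i ∉ Ω} ∪
          {x ∈ Ω | x + (n * t) • (-e i) ∉ Ω}) :=
        (measure_mono hsub).trans (measure_iUnion_fintype_le _ _)
    _ ≤ ∑ _i : Fin n, (ENNReal.ofReal (n * t / R) * V + ENNReal.ofReal (n * t / R) * V) := by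
        refine Finset.sum_le_sum fun i _ => (measure_union_le _ _).trans (add_le_add ?_ ?_)
        · exact volume_sdiff_translate_le hR hs hΩ hc hΩR (he1 i)
        · exact volume_sdiff_translate_le hR hs hΩ hc hΩR (by rw [norm_neg, he1])
    _ = _ := by
        rw [ENNReal.ofReal_mul (by positivity), ENNReal.ofReal_mul (by positivity)]
        simp only [Finset.sum_const, Finset.card_univ, Fintype.card_fin, nsmul_eq_mul,
          ENNReal.ofReal_natCast, ENNReal.ofReal_ofNat]
        ring

/-- The layer cake bound for negative powers of a nonnegative function whose sublevel sets have
linearly growing measure. -/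
theorem lintegral_rpow_neg_le {α : Type*} [MeasurableSpace α] {μ : Measure α} {d : α → ℝ}
    (hd : Measurable d) (hd0 : ∀ x, 0 ≤ d x) {C q : ℝ} (hq : 0 < q)
    (h : ∀ t, 0 < t → μ {x | d x < t} ≤ ENNReal.ofReal (C * t)) :
    ∫⁻ x, ENNReal.ofReal (d x ^ (-q)) ∂μ ≤
      μ univ + ∫⁻ s in Ioi 1, ENNReal.ofReal (C * s ^ (-(1 / q))) := by
  rw [lintegral_eq_lintegral_meas_lt μ (.of_forall fun x => Real.rpow_nonneg (hd0 x) _)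
    (hd.pow_const _).aemeasurable, ← Ioc_union_Ioi_eq_Ioi zero_le_one,
    lintegral_union measurableSet_Ioi (by simp)]
  refine add_le_add ?_ ?_
  · calc ∫⁻ s in Ioc (0 : ℝ) 1, μ {a | s < d a ^ (-q)} ≤ ∫⁻ _ in Ioc (0 : ℝ) 1, μ univ :=
          lintegral_mono fun s => measure_mono (subset_univ _)
      _ = μ univ := by simp
  · refine setLIntegral_mono' measurableSet_Ioi fun s hs => ?_
    have hs0 : 0 < s := one_pos.trans hs
    refine (measure_mono fun x hx => ?_).trans (h _ (Real.rpow_pos_of_pos hs0 _))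
    have hx' : s < d x ^ (-q) := hx
    -- With the convention `0 ^ (-q) = 0`, points where `d` vanishes never lie in a superlevel set
    -- with `s > 1`.
    rcases (hd0 x).eq_or_lt with h0 | h0
    · rw [← h0, Real.zero_rpow (by linarith)] at hx'
      linarith
    · have h1 := Real.rpow_lt_rpow_of_neg hs0 hx' (z := -(1 / q)) (by simpa using hq)
      rwa [← Real.rpow_mul h0.le, neg_mul_neg, mul_one_div_cancel hq.ne', Real.rpow_one] at h1

/-- Powers of the distance to the boundary of a bounded convex set are integrable up to the
exponent `-1`. -/
theorem exists_lintegral_infDist_rpow_le {n : ℕ} (hn : 1 ≤ n) {R q : ℝ} (hR : 0 < R) (hq : q < 1) :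
    ∃ C : ℝ≥0, ∀ Ω : Set (EuclideanSpace ℝ (Fin n)), IsOpen Ω → Convex ℝ Ω → Ω ⊆ Metric.ball 0 R →
      ∫⁻ x in Ω, ENNReal.ofReal (Metric.infDist x (frontier Ω) ^ (-q)) ≤ C := by
  set V := volume (Metric.ball (0 : EuclideanSpace ℝ (Fin n)) (2 * R)) with hV
  have hVtop : V ≠ ⊤ := Metric.isBounded_ball.measure_lt_top.ne
  -- The layer cake bound needs a positive exponent, whereas `q` may be nonpositive. As the distance
  -- is at most `2 R`, raising the exponent to `q'` costs only `(2 R) ^ (q' - q)`, and `q' < 1`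
  -- keeps the tail integral finite.
  set q' := max q (1 / 2) with hq'
  have hq'0 : 0 < q' := lt_of_lt_of_le (by norm_num) (le_max_right _ _)
  have hq'1 : q' < 1 := max_lt hq (by norm_num)
  set C₁ := 2 * n * (n / R) * V.toReal with hC₁
  set B := ENNReal.ofReal ((2 * R) ^ (q' - q)) *
    (V + ∫⁻ s in Ioi (1 : ℝ), ENNReal.ofReal (C₁ * s ^ (-(1 / q')))) with hB
  have hBtop : B ≠ ⊤ := by
    refine ENNReal.mul_ne_top ENNReal.ofReal_ne_top (ENNReal.add_ne_top.2 ⟨hVtop, ?_⟩)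
    have hint : IntegrableOn (fun s : ℝ => C₁ * s ^ (-(1 / q'))) (Ioi 1) :=
      (integrableOn_Ioi_rpow_of_lt (by
        rw [neg_lt_neg_iff, lt_div_iff₀ hq'0]; linarith) one_pos).const_mul _
    exact hint.lintegral_lt_top.ne
  refine ⟨B.toNNReal, fun Ω hΩ hc hΩR => ?_⟩
  rw [ENNReal.coe_toNNReal hBtop]
  have hpt : ∀ x ∈ Ω, ENNReal.ofReal (Metric.infDist x (frontier Ω) ^ (-q)) ≤
      ENNReal.ofReal ((2 * R) ^ (q' - q)) *
        ENNReal.ofReal (Metric.infDist x (frontier Ω) ^ (-q')) := by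
    intro x hx
    rw [← ENNReal.ofReal_mul (by positivity)]
    refine ENNReal.ofReal_le_ofReal ?_
    have : Nonempty (Fin n) := ⟨⟨0, by lia⟩⟩
    -- The frontier must be shown nonempty, because `Metric.infDist` to the empty set is `0`.
    obtain ⟨w, _, hw⟩ := exists_add_smul_mem_frontier (Metric.isBounded_ball.subset hΩR) hx
      (e := EuclideanSpace.single (Classical.arbitrary (Fin n)) (1 : ℝ)) (by simp)
    have hdpos : 0 < Metric.infDist x (frontier Ω) := by
      rw [← isClosed_frontier.notMem_iff_infDist_pos ⟨_, hw⟩]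
      exact fun h => hΩ.inter_frontier_eq.subset ⟨hx, h⟩
    have hd2 : Metric.infDist x (frontier Ω) ≤ 2 * R :=
      (Metric.infDist_le_dist_of_mem hw).trans
        (dist_le_two_mul_of_mem_closure hΩR (subset_closure hx) (frontier_subset_closure hw))
    have : -q = (q' - q) + -q' := by ring
    rw [this, Real.rpow_add hdpos]
    have : 0 ≤ q' - q := sub_nonneg.2 (le_max_left _ _)
    gcongr
  calc _ ≤ ∫⁻ x in Ω, ENNReal.ofReal ((2 * R) ^ (q' - q)) *
        ENNReal.ofReal (Metric.infDist x (frontier Ω) ^ (-q')) :=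
        setLIntegral_mono' hΩ.measurableSet hpt
    _ = ENNReal.ofReal ((2 * R) ^ (q' - q)) *
        ∫⁻ x in Ω, ENNReal.ofReal (Metric.infDist x (frontier Ω) ^ (-q')) :=
        lintegral_const_mul' _ _ ENNReal.ofReal_ne_top
    _ ≤ _ := by
      rw [hB]
      gcongr
      refine (lintegral_rpow_neg_le (C := C₁) (Metric.continuous_infDist_pt _).measurable
        (fun x => Metric.infDist_nonneg) hq'0 fun t ht => ?_).trans ?_
      · rw [Measure.restrict_apply
          (measurableSet_lt (Metric.continuous_infDist_pt _).measurable measurable_const),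
          inter_comm]
        refine (volume_infDist_lt_le hn hR ht hΩ hc hΩR).trans (le_of_eq ?_)
        rw [hC₁, ← hV, ← ENNReal.ofReal_toReal hVtop, ENNReal.toReal_ofReal ENNReal.toReal_nonneg,
          ← ENNReal.ofReal_mul (by positivity)]
        congr 1
        ring
      · gcongr
        rw [Measure.restrict_apply_univ]
        exact measure_mono (hΩR.trans (Metric.ball_subset_ball (by linarith)))

/-! ### Weak gradients of locally Lipschitz and convex functions. -/

/-- On an open set, local Lipschitz continuity gives Lipschitz continuity on open neighbourhoods. -/
theorem LocallyLipschitzOn.exists_isOpen {E : Type*} [PseudoEMetricSpace E]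
    {Ω : Set E} (hΩ : IsOpen Ω) {u : E → ℝ} (hu : LocallyLipschitzOn Ω u) {x : E} (hx : x ∈ Ω) :
    ∃ K : ℝ≥0, ∃ U ⊆ Ω, IsOpen U ∧ x ∈ U ∧ LipschitzOnWith K u U := by
  obtain ⟨K, t, ht, hK⟩ := hu hx
  rw [hΩ.nhdsWithin_eq hx] at ht
  obtain ⟨U, hU, hUo, hxU⟩ := mem_nhds_iff.1 (Filter.inter_mem ht (hΩ.mem_nhds hx))
  exact ⟨K, U, hU.trans inter_subset_right, hUo, hxU, hK.mono (hU.trans inter_subset_left)⟩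

section LocallyLipschitz

variable {n : ℕ} {Ω : Set (EuclideanSpace ℝ (Fin n))} {u : EuclideanSpace ℝ (Fin n) → ℝ}

/-- Rademacher's theorem applies near each point, and being a null set is a local property. -/
theorem LocallyLipschitzOn.ae_differentiableAt (hΩ : IsOpen Ω) (hu : LocallyLipschitzOn Ω u) :
    ∀ᵐ x ∂volume.restrict Ω, DifferentiableAt ℝ u x := by
  rw [ae_restrict_iff' hΩ.measurableSet, ae_iff]
  refine measure_null_of_locally_null _ fun x hx => ?_
  simp only [Classical.not_imp, mem_ofPred_eq] at hx
  obtain ⟨K, U, -, hUo, hxU, hK⟩ := hu.exists_isOpen hΩ hx.1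
  refine ⟨_, inter_mem_nhdsWithin _ (hUo.mem_nhds hxU), ?_⟩
  have h := hK.ae_differentiableWithinAt_of_mem (μ := volume)
  rw [ae_iff] at h
  refine measure_mono_null ?_ h
  rintro y ⟨hy, hyU⟩
  simp only [Classical.not_imp, mem_ofPred_eq] at hy ⊢
  exact ⟨hyU, fun hd => hy.2 (hd.differentiableAt (hUo.mem_nhds hyU))⟩

theorem measurable_gradient (u : EuclideanSpace ℝ (Fin n) → ℝ) : Measurable (gradient u) :=
  (InnerProductSpace.toDual ℝ (EuclideanSpace ℝ (Fin n))).symm.continuous.measurable.comp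
    (measurable_fderiv ℝ u)

theorem inner_gradient (x e : EuclideanSpace ℝ (Fin n)) :
    inner ℝ (gradient u x) e = fderiv ℝ u x e :=
  InnerProductSpace.toDual_symm_apply

theorem gradient_apply (x : EuclideanSpace ℝ (Fin n)) (i : Fin n) :
    gradient u x i = fderiv ℝ u x (EuclideanSpace.single i 1) := by
  rw [← inner_gradient, EuclideanSpace.inner_single_right]
  simp

theorem LocallyLipschitzOn.locallyIntegrableOn_gradient (hΩ : IsOpen Ω)
    (hu : LocallyLipschitzOn Ω u) : LocallyIntegrableOn (gradient u) Ω := by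
  intro x hx
  obtain ⟨K, U, -, hUo, hxU, hK⟩ := hu.exists_isOpen hΩ hx
  have hb : ∀ y ∈ U, ‖gradient u y‖ ≤ K := by
    intro y hy
    rw [gradient, LinearIsometryEquiv.norm_map]
    exact norm_fderiv_le_of_lipschitzOn ℝ (hUo.mem_nhds hy) hK
  refine (Measure.FiniteAtFilter.integrableAtFilter (l := nhds x) (f := gradient u)
    ⟨univ, Filter.univ_mem, (measurable_gradient u).aestronglyMeasurable⟩
    (Measure.finiteAt_nhds _ _) ?_).filter_mono nhdsWithin_le_nhds
  refine Filter.isBoundedUnder_of_eventually_le (a := (K : ℝ)) ?_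
  filter_upwards [hUo.mem_nhds hxU] with y hy using hb y hy

/-- A locally Lipschitz function is weakly differentiable and its weak gradient is the pointwise
gradient. -/
theorem LocallyLipschitzOn.isWeakGradient (hΩ : IsOpen Ω) (hu : LocallyLipschitzOn Ω u) :
    IsWeakGradient Ω u (gradient u) where
  locallyIntegrableOn := hu.continuousOn.locallyIntegrableOn hΩ.measurableSet
  locallyIntegrableOn_grad := hu.locallyIntegrableOn_gradient hΩ
  integral_eq := by
    intro φ hφ hφc hφΩ i
    -- On a compact thickening of the support, `u` is Lipschitz and extends to a globally Lipschitz
    -- `w`. The thickening makes `u` and `w` agree near the support, so their derivatives agree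
    -- there too, and integration by parts for `w` is enough.
    obtain ⟨δ, hδ, hδΩ⟩ := hφc.isCompact.exists_cthickening_subset_open hΩ hφΩ
    obtain ⟨K, hK⟩ := (hu.mono hδΩ).exists_lipschitzOnWith_of_compact hφc.isCompact.cthickening
    obtain ⟨w, hw, hwu⟩ := hK.extend_real
    obtain ⟨D, hD⟩ := hφ.lipschitzWith_of_hasCompactSupport hφc (by simp)
    have hibp := LipschitzWith.integral_lineDeriv_mul_eq (μ := volume) hw hD hφc (EuclideanSpace.single i 1)
    have hnear : ∀ x ∈ tsupport φ, u =ᶠ[nhds x] w := by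
      intro x hx
      have : Metric.thickening δ (tsupport φ) ∈ nhds x :=
        Metric.isOpen_thickening.mem_nhds (Metric.self_subset_thickening hδ _ hx)
      filter_upwards [this] with y hy using hwu (Metric.thickening_subset_cthickening _ _ hy)
    have hout : ∀ x, x ∉ tsupport φ → fderiv ℝ φ x = 0 := fun x hx =>
      fderiv_of_notMem_tsupport ℝ hx
    have e1 : ∫ x in Ω, u x * fderiv ℝ φ x (EuclideanSpace.single i 1) =
        - ∫ x, lineDeriv ℝ φ x (-(EuclideanSpace.single i 1)) * w x := by
      rw [setIntegral_eq_integral_of_forall_compl_eq_zero, ← integral_neg]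
      · refine integral_congr_ae (.of_forall fun x => ?_)
        have hd : DifferentiableAt ℝ φ x := hφ.differentiable (by simp) x
        simp only [hd.lineDeriv_eq_fderiv, map_neg]
        by_cases hx : x ∈ tsupport φ
        · rw [(hnear x hx).eq_of_nhds]; ring
        · simp [hout x hx]
      · intro x hx
        simp [hout x fun h => hx (hφΩ h)]
    have e2 : ∫ x in Ω, gradient u x i * φ x =
        ∫ x, lineDeriv ℝ w x (EuclideanSpace.single i 1) * φ x := by
      rw [setIntegral_eq_integral_of_forall_compl_eq_zero]
      · refine integral_congr_ae ?_
        filter_upwards [hw.ae_differentiableAt (μ := volume)] with x hd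
        by_cases hx : x ∈ tsupport φ
        · rw [hd.lineDeriv_eq_fderiv, gradient_apply, (hnear x hx).fderiv_eq]
        · simp [image_eq_zero_of_notMem_tsupport hx]
      · intro x hx
        simp [image_eq_zero_of_notMem_tsupport fun h => hx (hφΩ h)]
    rw [e1, e2, hibp]

/-- Weak gradients are unique almost everywhere. -/
theorem IsWeakGradient.ae_eq {v w : EuclideanSpace ℝ (Fin n) → EuclideanSpace ℝ (Fin n)}
    (hΩ : IsOpen Ω) (hv : IsWeakGradient Ω u v) (hw : IsWeakGradient Ω u w) :
    v =ᵐ[volume.restrict Ω] w := by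
  have hcomp : ∀ {v : EuclideanSpace ℝ (Fin n) → EuclideanSpace ℝ (Fin n)},
      LocallyIntegrableOn v Ω → ∀ i, LocallyIntegrableOn (fun x => v x i) Ω := by
    intro v hv i x hx
    obtain ⟨s, hs, hint⟩ := hv x hx
    exact ⟨s, hs, (EuclideanSpace.proj (𝕜 := ℝ) i).integrable_comp hint⟩
  have hint : ∀ {v : EuclideanSpace ℝ (Fin n) → EuclideanSpace ℝ (Fin n)},
      LocallyIntegrableOn v Ω → ∀ i (φ : EuclideanSpace ℝ (Fin n) → ℝ), Continuous φ →
      HasCompactSupport φ → tsupport φ ⊆ Ω → IntegrableOn (fun x => v x i * φ x) Ω := by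
    intro v hv i φ hφ hφc hφΩ
    have h1 : IntegrableOn (fun x => v x i) (tsupport φ) :=
      (hcomp hv i).integrableOn_compact_subset hφΩ hφc.isCompact
    have h2 := h1.mul_continuousOn hφ.continuousOn hφc.isCompact
    refine ((integrableOn_iff_integrable_of_support_subset ?_).1 h2).integrableOn
    exact (Function.support_mul_subset_right _ _).trans (subset_tsupport φ)
  have hzero : ∀ i, ∀ᵐ x ∂volume, x ∈ Ω → v x i - w x i = 0 := by
    intro i
    -- The fundamental lemma of the calculus of variations, one coordinate at a time.
    refine hΩ.ae_eq_zero_of_integral_contDiff_smul_eq_zero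
      ((hcomp hv.locallyIntegrableOn_grad i).sub (hcomp hw.locallyIntegrableOn_grad i)) ?_
    intro φ hφ hφc hφΩ
    have h1 := hv.integral_eq φ hφ hφc hφΩ i
    rw [hw.integral_eq φ hφ hφc hφΩ i, neg_inj] at h1
    rw [← setIntegral_eq_integral_of_forall_compl_eq_zero (s := Ω)]
    · calc ∫ x in Ω, φ x • (v x i - w x i)
          = ∫ x in Ω, (v x i * φ x - w x i * φ x) := by
            congr 1; ext x; simp only [smul_eq_mul]; ring
        _ = 0 := by
            rw [integral_sub (hint hv.locallyIntegrableOn_grad i φ hφ.continuous hφc hφΩ)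
              (hint hw.locallyIntegrableOn_grad i φ hφ.continuous hφc hφΩ), h1, sub_self]
    · intro x hx
      simp [image_eq_zero_of_notMem_tsupport fun h => hx (hφΩ h)]
  have : v =ᵐ[volume.restrict Ω] w := by
    rw [Filter.EventuallyEq, ae_restrict_iff' hΩ.measurableSet]
    filter_upwards [ae_all_iff.2 hzero] with x hx hxΩ
    ext i
    exact sub_eq_zero.1 (hx i hxΩ)
  exact this

/-- On the segment from `x` to `y` this is the one-variable fact that the slope of a convex function
over `[0, 1]` is at least its derivative at `0`. -/
theorem ConvexOn.gradient_mem_subdifferential (hu : ConvexOn ℝ Ω u)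
    {x : EuclideanSpace ℝ (Fin n)} (hx : x ∈ Ω) (hd : DifferentiableAt ℝ u x) :
    gradient u x ∈ subdifferential Ω u x := by
  intro y hy
  have hconv : ConvexOn ℝ (Icc (0 : ℝ) 1) (u ∘ AffineMap.lineMap x y) :=
    (hu.comp_affineMap (AffineMap.lineMap x y)).subset
      (fun t ht => hu.1.lineMap_mem hx hy ht) (convex_Icc 0 1)
  have hder : HasDerivAt (u ∘ AffineMap.lineMap (k := ℝ) x y) (fderiv ℝ u x (y - x)) 0 := by
    have h1 : HasFDerivAt u (fderiv ℝ u x) (AffineMap.lineMap x y (0 : ℝ)) := by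
      simpa using hd.hasFDerivAt
    exact h1.comp_hasDerivAt 0 AffineMap.hasDerivAt_lineMap
  have := hconv.le_slope_of_hasDerivAt (by simp) (by simp) one_pos hder
  rw [inner_gradient, map_sub]
  simp [slope] at this
  linarith

end LocallyLipschitz

/-! ### Weighted gradient estimates and the uniform constant. -/

/-- The weighted gradient estimate for a boundary datum with a given Hölder seminorm. -/
theorem exists_weighted_gradient_bound {n : ℕ} (hn : 1 ≤ n) {R Λ γ K p β : ℝ} (hR : 0 < R)
    (hΛ : 0 ≤ Λ) (hγ0 : 0 < γ) (hγ1 : γ < 1) (hγn : γ * n ≤ 2) (hK : 0 ≤ K) (hp : 0 ≤ p)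
    (hq : (1 - γ) * p - β < 1) :
    ∃ C : ℝ≥0, ∀ (Ω : Set (EuclideanSpace ℝ (Fin n))) (f g u : EuclideanSpace ℝ (Fin n) → ℝ),
      IsOpen Ω → Convex ℝ Ω → Ω ⊆ Metric.ball 0 R → (∀ᵐ x ∂volume.restrict Ω, f x ≤ Λ) →
      ConvexOn ℝ (closure Ω) g → ContinuousOn g (closure Ω) → IsAlexandrovSolution Ω f g u →
      (∀ x ∈ closure Ω, ∀ y ∈ closure Ω, |g x - g y| ≤ K * dist x y ^ γ) →
      ∀ v, IsWeakGradient Ω u v →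
        ∫⁻ x in Ω, ENNReal.ofReal (‖v x‖ ^ p * Metric.infDist x (frontier Ω) ^ β) ≤ C := by
  obtain ⟨L, hL, hgrad⟩ := exists_subgradient_bound hn hR hΛ hγ0 hγ1 hγn hK
  obtain ⟨B, hB⟩ := exists_lintegral_infDist_rpow_le hn hR hq
  refine ⟨(L ^ p).toNNReal * B, ?_⟩
  intro Ω f g u hΩ hc hΩR hf hg hgc hsol hgK v hv
  have hu : ConvexOn ℝ Ω u := hsol.convexOn.subset subset_closure hc
  have hlip := hu.locallyLipschitzOn hΩ
  have hpt : ∀ᵐ x ∂volume.restrict Ω,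
      ENNReal.ofReal (‖v x‖ ^ p * Metric.infDist x (frontier Ω) ^ β) ≤
        ENNReal.ofReal (L ^ p) *
          ENNReal.ofReal (Metric.infDist x (frontier Ω) ^ (-((1 - γ) * p - β))) := by
    filter_upwards [hv.ae_eq hΩ (hlip.isWeakGradient hΩ), hlip.ae_differentiableAt hΩ,
      ae_restrict_mem hΩ.measurableSet] with x hvx hd hx
    have h1 := hgrad Ω f g u hΩ hc hΩR hf hg hgc hsol hgK x hx _
      (hu.gradient_mem_subdifferential hx hd)
    rw [← hvx] at h1
    rw [← ENNReal.ofReal_mul (by positivity)]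
    refine ENNReal.ofReal_le_ofReal ?_
    have : Nonempty (Fin n) := ⟨⟨0, by lia⟩⟩
    obtain ⟨w, _, hw⟩ := exists_add_smul_mem_frontier (Metric.isBounded_ball.subset hΩR) hx
      (e := EuclideanSpace.single (Classical.arbitrary (Fin n)) (1 : ℝ)) (by simp)
    have hdpos : 0 < Metric.infDist x (frontier Ω) := by
      rw [← isClosed_frontier.notMem_iff_infDist_pos ⟨_, hw⟩]
      exact fun h => hΩ.inter_frontier_eq.subset ⟨hx, h⟩
    set d := Metric.infDist x (frontier Ω)
    calc ‖v x‖ ^ p * d ^ β ≤ (L * d ^ (γ - 1)) ^ p * d ^ β := by gcongr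
      _ = L ^ p * d ^ (-((1 - γ) * p - β)) := by
        rw [Real.mul_rpow hL (by positivity), ← Real.rpow_mul hdpos.le, mul_assoc,
          ← Real.rpow_add hdpos]
        congr 2
        ring
  calc _ ≤ ∫⁻ x in Ω, ENNReal.ofReal (L ^ p) *
          ENNReal.ofReal (Metric.infDist x (frontier Ω) ^ (-((1 - γ) * p - β))) :=
        lintegral_mono_ae hpt
    _ = ENNReal.ofReal (L ^ p) * ∫⁻ x in Ω,
          ENNReal.ofReal (Metric.infDist x (frontier Ω) ^ (-((1 - γ) * p - β))) :=
        lintegral_const_mul' _ _ ENNReal.ofReal_ne_top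
    _ ≤ ENNReal.ofReal (L ^ p) * B := by gcongr; exact hB Ω hΩ hc hΩR
    _ = _ := by rw [ENNReal.coe_mul]; rfl

/-- An exponent slightly below `μ` that keeps the integrability condition. -/
theorem exists_exponent_lt {μ p β : ℝ} (hμ : 0 < μ) (hp : 0 ≤ p) (hq : (1 - μ) * p - β < 1) :
    ∃ γ, 0 < γ ∧ γ < μ ∧ (1 - γ) * p - β < 1 := by
  -- Lowering `μ` by `ε` raises the left-hand side by `ε p`, which is at most half of the available
  -- gap.
  set ε := min (μ / 2) ((1 - ((1 - μ) * p - β)) / (2 * (p + 1))) with hε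
  have h1 : 0 < 1 - ((1 - μ) * p - β) := by linarith
  have hε0 : 0 < ε := lt_min (by linarith) (by positivity)
  have hε1 : ε ≤ μ / 2 := min_le_left _ _
  have hε2 : ε * (2 * (p + 1)) ≤ 1 - ((1 - μ) * p - β) := by
    rw [← le_div_iff₀ (by positivity)]; exact min_le_right _ _
  refine ⟨μ - ε, by linarith, by linarith, ?_⟩
  nlinarith [mul_nonneg hε0.le hp]

theorem modulusOfContinuity_le {n : ℕ} {Ω : Set (EuclideanSpace ℝ (Fin n))}
    {g : EuclideanSpace ℝ (Fin n) → ℝ} {K α : ℝ≥0} (hg : HolderOnWith K α g (closure Ω)) (δ : ℝ) :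
    modulusOfContinuity Ω g δ ≤ ENNReal.ofReal (K * δ ^ (α : ℝ)) := by
  refine iSup₂_le fun x hx => iSup₂_le fun y hy => iSup_le fun hxy => ENNReal.ofReal_le_ofReal ?_
  have h1 := hg.dist_le hx hy
  rw [Real.dist_eq] at h1
  refine h1.trans ?_
  gcongr

theorem abs_sub_le_of_modulusOfContinuity_le {n : ℕ} {Ω : Set (EuclideanSpace ℝ (Fin n))}
    {g : EuclideanSpace ℝ (Fin n) → ℝ} {B : ℝ} (hB : 0 ≤ B) {x y : EuclideanSpace ℝ (Fin n)}
    (hx : x ∈ closure Ω) (hy : y ∈ closure Ω)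
    (h : modulusOfContinuity Ω g (dist x y) ≤ ENNReal.ofReal B) : |g x - g y| ≤ B := by
  rw [← ENNReal.ofReal_le_ofReal_iff hB]
  refine le_trans ?_ h
  exact le_iSup₂_of_le x hx (le_iSup₂_of_le y hy (le_iSup_of_le le_rfl le_rfl))

theorem mul_dist_rpow_le_of_subset_ball {n : ℕ} {Ω : Set (EuclideanSpace ℝ (Fin n))} {R : ℝ}
    (hΩR : Ω ⊆ Metric.ball 0 R) {K α γ : ℝ} (hK : 0 ≤ K) (hγ : 0 < γ) (hγα : γ ≤ α)
    {x y : EuclideanSpace ℝ (Fin n)} (hx : x ∈ closure Ω) (hy : y ∈ closure Ω) :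
    K * dist x y ^ α ≤ K * (2 * R) ^ (α - γ) * dist x y ^ γ := by
  rcases (dist_nonneg (x := x) (y := y)).eq_or_lt with h | h
  · rw [← h, Real.zero_rpow (hγ.trans_le hγα).ne', Real.zero_rpow hγ.ne']
    simp
  · have h1 := dist_le_two_mul_of_mem_closure hΩR hx hy
    have h2 : dist x y ^ (α - γ) ≤ (2 * R) ^ (α - γ) :=
      Real.rpow_le_rpow h.le h1 (by linarith)
    calc K * dist x y ^ α = K * dist x y ^ (α - γ) * dist x y ^ γ := by
          rw [mul_assoc, ← Real.rpow_add h, sub_add_cancel]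
      _ ≤ _ := by gcongr

theorem IsHolderDirichletData.convexOn_domain {n : ℕ} {R Λ : ℝ} {α : ℝ≥0}
    {Ω : Set (EuclideanSpace ℝ (Fin n))} {f g u : EuclideanSpace ℝ (Fin n) → ℝ}
    (h : IsHolderDirichletData R Λ α Ω f g u) : ConvexOn ℝ Ω u :=
  h.solution.convexOn.subset subset_closure h.convex

theorem IsHolderDirichletData.isWeakGradient_gradient {n : ℕ} {R Λ : ℝ} {α : ℝ≥0}
    {Ω : Set (EuclideanSpace ℝ (Fin n))} {f g u : EuclideanSpace ℝ (Fin n) → ℝ}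
    (h : IsHolderDirichletData R Λ α Ω f g u) : IsWeakGradient Ω u (gradient u) :=
  (h.convexOn_domain.locallyLipschitzOn h.isOpen).isWeakGradient h.isOpen

/-- The constant must be fixed before `α` and the data, knowing only the modulus `m`. If some
admissible exponent and Hölder constant bound `m`, one such pair is chosen and serves for all data
with this modulus, whatever their own `α`. If there is none, no data satisfy the hypotheses. -/
theorem exists_uniform_weighted_gradient_bound {n : ℕ} (hn : 2 ≤ n) (R Λ p β : ℝ)
    (m : ℝ → ℝ≥0∞) (hp : 0 ≤ p) :
    ∃ C : ℝ≥0, ∀ (α : ℝ≥0) (Ω : Set (EuclideanSpace ℝ (Fin n)))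
      (f g u : EuclideanSpace ℝ (Fin n) → ℝ),
      0 < α → α ≤ 1 → IsHolderDirichletData R Λ α Ω f g u →
      (∀ δ : ℝ, 0 ≤ δ → modulusOfContinuity Ω g δ = m δ) →
      (1 - min (2 / (n : ℝ)) (α : ℝ)) * p - β < 1 →
        ∀ v, IsWeakGradient Ω u v →
          ∫⁻ x in Ω, ENNReal.ofReal (‖v x‖ ^ p * Metric.infDist x (frontier Ω) ^ β) ≤ C := by
  by_cases hex : ∃ (α K : ℝ≥0), 0 < α ∧ (1 - min (2 / (n : ℝ)) (α : ℝ)) * p - β < 1 ∧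
      ∀ δ : ℝ, 0 ≤ δ → m δ ≤ ENNReal.ofReal (K * δ ^ (α : ℝ))
  · obtain ⟨α, K, hα, hq, hm⟩ := hex
    have hn0 : (2 : ℝ) ≤ n := by exact_mod_cast hn
    have hμ : 0 < min (2 / (n : ℝ)) (α : ℝ) := lt_min (by positivity) (by exact_mod_cast hα)
    obtain ⟨γ, hγ0, hγμ, hγq⟩ := exists_exponent_lt hμ hp hq
    have hγ2 : γ < 2 / n := hγμ.trans_le (min_le_left _ _)
    have hγα : γ ≤ α := (hγμ.trans_le (min_le_right _ _)).le
    have hγn : γ * n < 2 := (lt_div_iff₀ (by linarith)).1 hγ2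
    have hγ1 : γ < 1 := hγ2.trans_le ((div_le_one (by linarith)).2 hn0)
    -- No signs of `R` and `Λ` are assumed, so both are enlarged, to `max R 1` and `max Λ 0`.
    have hR' : 0 < max R 1 := lt_max_of_lt_right one_pos
    obtain ⟨C, hC⟩ := exists_weighted_gradient_bound (n := n) (by lia) hR' (le_max_right Λ 0)
      hγ0 hγ1 hγn.le (K := K * (2 * max R 1) ^ (α - γ)) (by positivity) hp hγq
    refine ⟨C, fun α' Ω f g u hα' _ h hmod _ v hv => ?_⟩
    -- The data's own Hölder bound serves only for continuity of `g`; the quantitative bound comes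
    -- from `m`.
    obtain ⟨K', hK'⟩ := h.holder
    have hΩR : Ω ⊆ Metric.ball 0 (max R 1) :=
      h.subset_ball.trans (Metric.ball_subset_ball (le_max_left _ _))
    refine hC Ω f g u h.isOpen h.convex hΩR (h.bounds.mono fun x hx => hx.2.trans (le_max_left _ _))
      h.convexOn (hK'.continuousOn hα') h.solution (fun x hx y hy => ?_) v hv
    refine le_trans ?_ (mul_dist_rpow_le_of_subset_ball hΩR K.2 hγ0 hγα hx hy)
    refine abs_sub_le_of_modulusOfContinuity_le
      (mul_nonneg K.2 (Real.rpow_nonneg dist_nonneg _)) hx hy ?_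
    rw [hmod _ dist_nonneg]
    exact hm _ dist_nonneg
  · refine ⟨0, fun α Ω f g u hα _ h hmod hq => (hex ?_).elim⟩
    obtain ⟨K, hK⟩ := h.holder
    refine ⟨α, K, hα, hq, fun δ hδ => ?_⟩
    rw [← hmod δ hδ]
    exact modulusOfContinuity_le hK δ

/-- Includes `c = 0`, where the upper limit is `⊤`; this is the case `n = 2`, `α = 1`. -/
theorem mul_toReal_lt_one {c : ℝ} (hc : 0 ≤ c) {p : ℝ≥0∞} (hp : p < (ENNReal.ofReal c)⁻¹) :
    c * p.toReal < 1 := by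
  rcases hc.eq_or_lt with rfl | hc
  · simp
  · rw [← ENNReal.ofReal_inv_of_pos hc, ENNReal.lt_ofReal_iff_toReal_lt hp.ne_top] at hp
    rw [mul_comm, ← lt_div_iff₀ hc, one_div]
    exact hp

theorem IsHolderDirichletData.memW1p {n : ℕ} (hn : 2 ≤ n) {R Λ : ℝ} {α : ℝ≥0}
    {Ω : Set (EuclideanSpace ℝ (Fin n))} {f g u : EuclideanSpace ℝ (Fin n) → ℝ} (hα0 : 0 < α)
    (hα1 : α ≤ 1) (h : IsHolderDirichletData R Λ α Ω f g u) {p : ℝ≥0∞} (hp1 : 1 ≤ p)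
    (hp : p < (ENNReal.ofReal (1 - min (2 / (n : ℝ)) (α : ℝ)))⁻¹) : MemW1p Ω p u := by
  have hp0 : p ≠ 0 := (one_pos.trans_le hp1).ne'
  have hptop : p ≠ ⊤ := hp.ne_top
  have hb : Bornology.IsBounded Ω := Metric.isBounded_ball.subset h.subset_ball
  have hfin : IsFiniteMeasure (volume.restrict Ω) := ⟨by
    rw [Measure.restrict_apply_univ]; exact hb.measure_lt_top⟩
  refine ⟨?_, gradient u, h.isWeakGradient_gradient, (measurable_gradient u).aestronglyMeasurable,
    ?_⟩
  · obtain ⟨B, hB⟩ := hb.isCompact_closure.exists_bound_of_continuousOn h.solution.continuousOn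
    refine MemLp.of_bound ((h.solution.continuousOn.mono subset_closure).aestronglyMeasurable
      h.isOpen.measurableSet) B ?_
    filter_upwards [ae_restrict_mem h.isOpen.measurableSet] with x hx using hB x (subset_closure hx)
  · have hc : 0 ≤ 1 - min (2 / (n : ℝ)) (α : ℝ) :=
      sub_nonneg.2 ((min_le_right _ _).trans (by exact_mod_cast hα1))
    -- The weight is trivial for `β = 0`, and the modulus is that of `g` itself.
    obtain ⟨C, hC⟩ := exists_uniform_weighted_gradient_bound hn R Λ p.toReal 0
      (modulusOfContinuity Ω g) ENNReal.toReal_nonneg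
    have h1 := hC α Ω f g u hα0 hα1 h (fun _ _ => rfl)
      (by rw [sub_zero]; exact mul_toReal_lt_one hc hp) _ h.isWeakGradient_gradient
    rw [eLpNorm_lt_top_iff_lintegral_rpow_enorm_lt_top hp0 hptop]
    refine lt_of_le_of_lt (le_of_eq ?_) (h1.trans_lt ENNReal.coe_lt_top)
    refine lintegral_congr fun x => ?_
    rw [Real.rpow_zero, mul_one, ← ENNReal.ofReal_rpow_of_nonneg (norm_nonneg _)
      ENNReal.toReal_nonneg, ofReal_norm]

theorem mainTheorem4 {n : ℕ} (hn : 2 ≤ n) :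
    (∀ (R Λ p β : ℝ) (m : ℝ → ℝ≥0∞), 0 ≤ p → 0 ≤ β →
      ∃ C : ℝ≥0, ∀ (α : ℝ≥0) (Ω : Set (EuclideanSpace ℝ (Fin n)))
        (f g u : EuclideanSpace ℝ (Fin n) → ℝ),
        0 < α → α ≤ 1 → IsHolderDirichletData R Λ α Ω f g u →
        (∀ δ : ℝ, 0 ≤ δ → modulusOfContinuity Ω g δ = m δ) →
        (1 - min (2 / (n : ℝ)) (α : ℝ)) * p - β < 1 →
          (∃ v, IsWeakGradient Ω u v) ∧
          ∀ v, IsWeakGradient Ω u v →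
            ∫⁻ x in Ω, ENNReal.ofReal (‖v x‖ ^ p * Metric.infDist x (frontier Ω) ^ β) ≤ C) ∧
    (∀ (R Λ : ℝ) (α : ℝ≥0) (Ω : Set (EuclideanSpace ℝ (Fin n)))
      (f g u : EuclideanSpace ℝ (Fin n) → ℝ),
      0 < α → α ≤ 1 → IsHolderDirichletData R Λ α Ω f g u →
      ∀ p : ℝ≥0∞, 1 ≤ p → p < (ENNReal.ofReal (1 - min (2 / (n : ℝ)) (α : ℝ)))⁻¹ →
        MemW1p Ω p u) := by
  refine ⟨fun R Λ p β m hp _ => ?_, fun R Λ α Ω f g u hα0 hα1 h p hp1 hp =>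
    h.memW1p hn hα0 hα1 hp1 hp⟩
  obtain ⟨C, hC⟩ := exists_uniform_weighted_gradient_bound hn R Λ p β m hp
  exact ⟨C, fun α Ω f g u hα0 hα1 h hmod hq =>
    ⟨⟨_, h.isWeakGradient_gradient⟩, hC α Ω f g u hα0 hα1 h hmod hq⟩⟩
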